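/- For a permutation $\pi=\pi_1\cdots\pi_n\in S_n$, let $\operatorname{des}(\pi)=\#\{1\le i<n:\pi_i>\pi_{i+1}\}$ and $\operatorname{maxdrop}(\pi)=\max\{i-\pi_i : 1\le i\le n\}$ (equal to $0$ for the empty permutation, $n=0$). Let $A_{n,k}(213)$ be the set of all $\pi\in S_n$ with $\operatorname{maxdrop}(\pi)\le k$ that avoid the classical pattern $213$, i.e. for which there are no $a<b<c$ with $\pi_b<\pi_a<\pi_c$. Let $$G(p,q,z)=\sum_{0\le k\le n}\ \sum_{\pi\in A_{n,k}(213)}p^{\operatorname{des}(\pi)}q^kz^n .$$ Then, as formal power series in $p,q,z$ over $\mathbb{Q}$, $$G(p,q,z)=\frac{1-pqz-(1-z)q+(zq-pqz-q)\widetilde F_0}{1-z-pqz-(1-z)q},$$ where $$\widetilde F_0=\frac{1-zq(1+p)-\sqrt{(1+zq(1-p))^2-4zq}}{2pqz}.$$ Here the square root is the formal power series with constant term $1$; the series $1-zq(1+p)-\sqrt{(1+zq(1-p))^2-4zq}$ is divisible by $2pqz$, so $\widetilde F_0$ is a well-defined formal power series, and the denominator of $G$ has constant term $1$, hence is invertible.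 -/

import Mathlib

namespace BoundedPerm

/-- `π` avoids the classical pattern `σ`: no subsequence `π (f 0), π (f 1), …` of `π`
(with `f` strictly increasing) is order-isomorphic to `σ`. -/
def Avoids {m n : ℕ} (σ : Equiv.Perm (Fin m)) (π : Equiv.Perm (Fin n)) : Prop :=
  ¬ ∃ f : Fin m → Fin n, StrictMono f ∧ ∀ a b : Fin m, π (f a) < π (f b) ↔ σ a < σ b

/-- The pattern `213`, on the letters `0, 1, 2`: `0 ↦ 1`, `1 ↦ 0`, `2 ↦ 2`. -/
def pattern213 : Equiv.Perm (Fin 3) := Equiv.swap 0 1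

/-- Number of descents: the number of positions `i` with a successor such that `π i > π (i+1)`. -/
noncomputable def des {n : ℕ} (π : Equiv.Perm (Fin n)) : ℕ :=
  Nat.card {i : Fin n // ∃ h : (i : ℕ) + 1 < n, π ⟨(i : ℕ) + 1, h⟩ < π i}

/-- Maximum drop size, `max_i (i - π i)`. The truncated subtraction is harmless: the maximum of the
integers `i - π i` is nonnegative, since these integers sum to zero. It is `0` for `n = 0`. -/
def maxdrop {n : ℕ} (π : Equiv.Perm (Fin n)) : ℕ :=
  Finset.univ.sup fun i : Fin n => (i : ℕ) - (π i : ℕ)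

/-- `A_{n,k}(σ)`: the `σ`-avoiding permutations of length `n` with maximum drop size at most `k`. -/
def boundedAvoiding {m : ℕ} (n k : ℕ) (σ : Equiv.Perm (Fin m)) : Set (Equiv.Perm (Fin n)) :=
  {π | maxdrop π ≤ k ∧ Avoids σ π}

/-- The formal power series `G(p,q,z) = ∑_{0 ≤ k ≤ n} ∑_{π ∈ A_{n,k}(213)} p^(des π) q^k z^n`, where
`p`, `q`, `z` are the variables `0`, `1`, `2`. It is given by its coefficients: the coefficient of
`p^d q^k z^n` is the number of `π ∈ A_{n,k}(213)` with `d` descents if `k ≤ n`, and `0` if not. -/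
noncomputable def G : MvPowerSeries (Fin 3) ℚ := fun e =>
  if e 1 ≤ e 2 then
    (Nat.card {π : Equiv.Perm (Fin (e 2)) //
      π ∈ boundedAvoiding (e 2) (e 1) pattern213 ∧ des π = e 0} : ℚ)
  else 0

/-- `S` is the formal square root `√A` (for `A` with constant term `1`): the series with square `A`
and constant term `1`. -/
def IsSqrt (S A : MvPowerSeries (Fin 3) ℚ) : Prop :=
  S ^ 2 = A ∧ MvPowerSeries.constantCoeff S = 1

end BoundedPerm

namespace BoundedPerm

open Finset MvPowerSeries

/-! Split a nonempty 213-avoider at its smallest letter as L 0 R. Each letter of L exceeds each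
letter of R, since otherwise it would form 213 with the 0 and a letter of R. So L and R are
arbitrary avoiders (`exists_join`, `join_injective`). Descents add, with one more if L is nonempty
(`descents_join`), and the maximum drop is |L| plus that of R (`drop_join_le_iff`).

Let F count nonempty avoiders by p^des (qz)^n. Then F = qz(1 + pF)(1 + F) (`nonemptySeries_eq`), the
quadratic solved by the stated radical. For G, the bound k = n is vacuous and contributes 1 + F. If
k < n, write k = |L| + k'; then k' bounds the drops of R and k' ≤ |R|, so G = (1 + F) + z(1 + pF)G
(`genFun_weight_eq`). Eliminating with the quadratic gives the formula. -/

/-! ### Generating functions of weighted classes -/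

section GeneratingFunction

variable {σ α β : Type*}

/-- The generating function of a class `α` with weights `w`: the coefficient at `e` is the number of
elements of weight `e`. -/
noncomputable def genFun (w : α → σ →₀ ℕ) : MvPowerSeries σ ℚ :=
  fun e => (Nat.card {a // w a = e} : ℚ)

theorem coeff_genFun (w : α → σ →₀ ℕ) (e : σ →₀ ℕ) :
    coeff e (genFun w) = (Nat.card {a // w a = e} : ℚ) := rfl

theorem genFun_congr (f : α ≃ β) {u : α → σ →₀ ℕ} {v : β → σ →₀ ℕ} (h : ∀ a, v (f a) = u a) :
    genFun u = genFun v := by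
  ext e
  rw [coeff_genFun, coeff_genFun]
  exact congrArg _ (Nat.card_congr (f.subtypeEquiv fun a => by rw [h]))

theorem genFun_unique [Unique α] (w : α → σ →₀ ℕ) :
    genFun w = monomial (w default) 1 := by
  classical
  ext e
  rw [coeff_genFun, coeff_monomial]
  by_cases h : e = w default
  · rw [if_pos h]
    have : Unique {a // w a = e} :=
      ⟨⟨⟨default, h.symm⟩⟩, fun x => Subtype.ext (Unique.eq_default _)⟩
    simp
  · rw [if_neg h]
    have : IsEmpty {a // w a = e} :=
      ⟨fun x => h (by rw [← x.2, Unique.eq_default x.1])⟩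
    simp

theorem genFun_add_compl (w : α → σ →₀ ℕ) (hw : ∀ e, Finite {a // w a = e}) (P : α → Prop) :
    genFun w = genFun (fun a : {a // P a} => w a) + genFun (fun a : {a // ¬ P a} => w a) := by
  classical
  ext e
  rw [map_add, coeff_genFun, coeff_genFun, coeff_genFun, ← Nat.cast_add]
  congr 1
  have := hw e
  have key : ∀ Q : α → Prop, Nat.card {a : {a // Q a} // w a = e} =
      Nat.card {a : {a // w a = e} // Q a} := fun Q =>
    Nat.card_congr ⟨fun a => ⟨⟨a.1.1, a.2⟩, a.1.2⟩, fun a => ⟨⟨a.1.1, a.2⟩, a.1.2⟩,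
      fun _ => rfl, fun _ => rfl⟩
  rw [key, key, ← Nat.card_sum]
  exact Nat.card_congr (Equiv.sumCompl _).symm

/-- Pairs of total weight e are sorted by the splitting of e. Finiteness matters because `Nat.card`
of an infinite type is 0, which breaks additivity. -/
theorem genFun_prod (u : α → σ →₀ ℕ) (v : β → σ →₀ ℕ) (hu : ∀ e, Finite {a // u a = e})
    (hv : ∀ e, Finite {b // v b = e}) :
    genFun (fun x : α × β => u x.1 + v x.2) = genFun u * genFun v := by
  classical
  ext e
  rw [coeff_mul]
  simp_rw [coeff_genFun, ← Nat.cast_mul, ← Nat.cast_sum, ← Nat.card_prod]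
  congr 1
  rw [← Finset.sum_coe_sort (antidiagonal e)
    (fun p => Nat.card ({a // u a = p.1} × {b // v b = p.2})), ← Nat.card_sigma]
  refine Nat.card_congr
    { toFun := fun x => ⟨⟨(u x.1.1, v x.1.2), mem_antidiagonal.2 x.2⟩, ⟨x.1.1, rfl⟩, ⟨x.1.2, rfl⟩⟩
      invFun := fun y => ⟨(y.2.1.1, y.2.2.1), by
        rw [y.2.1.2, y.2.2.2]; exact mem_antidiagonal.1 y.1.2⟩
      left_inv := fun x => rfl
      right_inv := ?_ }
  rintro ⟨⟨⟨e₁, e₂⟩, he⟩, ⟨a, ha⟩, ⟨b, hb⟩⟩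
  dsimp only at ha hb
  subst ha hb
  rfl

theorem genFun_shift (c : σ →₀ ℕ) (w : α → σ →₀ ℕ) (hw : ∀ e, Finite {a // w a = e}) :
    genFun (fun a => c + w a) = monomial c 1 * genFun w := by
  have h := genFun_prod (fun _ : Unit => c) w (fun _ => inferInstance) hw
  rw [genFun_unique (fun _ : Unit => c)] at h
  rw [← h]
  exact genFun_congr (Equiv.punitProd α).symm fun a => rfl

end GeneratingFunction

/-! ### Exponents in three variables -/

/-- The exponent of `p^d q^k z^n`. -/
noncomputable def expo (d k n : ℕ) : Fin 3 →₀ ℕ := Finsupp.equivFunOnFinite.symm ![d, k, n]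

theorem expo_eq_iff {d k n : ℕ} {e : Fin 3 →₀ ℕ} :
    expo d k n = e ↔ d = e 0 ∧ k = e 1 ∧ n = e 2 := by
  constructor
  · rintro rfl; simp [expo]
  · rintro ⟨rfl, rfl, rfl⟩
    ext i
    fin_cases i <;> simp [expo]

theorem expo_add (d k n d' k' n' : ℕ) :
    expo d k n + expo d' k' n' = expo (d + d') (k + k') (n + n') := by
  symm
  rw [expo_eq_iff]
  simp [expo]

theorem monomial_expo (d k n : ℕ) :
    monomial (expo d k n) (1 : ℚ) = X 0 ^ d * X 1 ^ k * X 2 ^ n := by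
  rw [X_pow_eq, X_pow_eq, X_pow_eq, monomial_mul_monomial, monomial_mul_monomial]
  congr 2
  · rw [expo_eq_iff]; simp
  · simp

/-! ### The class of `213`-avoiding permutations -/

theorem avoids_pattern213_iff {n : ℕ} (π : Equiv.Perm (Fin n)) :
    Avoids pattern213 π ↔ ∀ a b c : Fin n, a < b → b < c → π b < π a → ¬ π a < π c := by
  constructor
  · intro h a b c hab hbc h1 h2
    refine h ⟨![a, b, c], ?_, ?_⟩
    · rw [Fin.strictMono_iff_lt_succ]
      intro i
      fin_cases i
      · exact hab
      · exact hbc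
    · have h3 := h1.trans h2
      intro i j
      fin_cases i <;> fin_cases j <;>
        simp [pattern213, Equiv.swap_apply_def, h1, h2, h3, h1.le, h2.le, h3.le]
  · rintro h ⟨f, hf, hπ⟩
    exact h (f 0) (f 1) (f 2) (hf (by decide)) (hf (by decide))
      ((hπ 1 0).2 (by decide)) ((hπ 0 2).2 (by decide))

/-- The `213`-avoiding permutations of all lengths. -/
def Avoider : Type := Σ n : ℕ, {π : Equiv.Perm (Fin n) // Avoids pattern213 π}

namespace Avoider

/-- The length of a permutation. -/
def size (a : Avoider) : ℕ := a.1

/-- The one-line notation of a permutation, continued by `0`. -/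
def val (a : Avoider) (i : ℕ) : ℕ := if h : i < a.1 then a.2.1 ⟨i, h⟩ else 0

/-- The number of descents. -/
noncomputable def descents (a : Avoider) : ℕ := des a.2.1

/-- The maximum drop size. -/
def drop (a : Avoider) : ℕ := maxdrop a.2.1

/-! ### Avoiders and their statistics in one-line notation -/

theorem val_eq (a : Avoider) {i : ℕ} (h : i < a.size) : a.val i = a.2.1 ⟨i, h⟩ := dif_pos h

theorem val_lt (a : Avoider) {i : ℕ} (h : i < a.size) : a.val i < a.size := by
  rw [val_eq a h]; exact Fin.is_lt _

theorem val_inj (a : Avoider) {i j : ℕ} (hi : i < a.size) (hj : j < a.size)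
    (h : a.val i = a.val j) : i = j := by
  rw [val_eq a hi, val_eq a hj] at h
  exact congrArg Fin.val (a.2.1.injective (Fin.ext h))

theorem val_avoids (a : Avoider) {i j k : ℕ} (hij : i < j) (hjk : j < k) (hk : k < a.size)
    (h : a.val j < a.val i) : a.val k ≤ a.val i := by
  have hj := hjk.trans hk
  have hi := hij.trans hj
  rw [val_eq a hi, val_eq a hj] at h
  rw [val_eq a hi, val_eq a hk]
  exact not_lt.1 ((avoids_pattern213_iff _).1 a.2.2 ⟨i, hi⟩ ⟨j, hj⟩ ⟨k, hk⟩ hij hjk h)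

theorem exists_val_eq (a : Avoider) {y : ℕ} (hy : y < a.size) : ∃ i < a.size, a.val i = y := by
  obtain ⟨i, hi⟩ := a.2.1.surjective ⟨y, hy⟩
  refine ⟨i, i.2, ?_⟩
  rw [val_eq a i.2, hi]

@[ext]
theorem ext {a b : Avoider} (hs : a.size = b.size) (hv : ∀ i < a.size, a.val i = b.val i) :
    a = b := by
  obtain ⟨n, π, hπ⟩ := a
  obtain ⟨m, ρ, hρ⟩ := b
  obtain rfl : n = m := hs
  obtain rfl : π = ρ := by
    ext i
    have := hv i i.2
    simpa [val] using this
  rfl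

/-- An avoider from its one-line notation. -/
noncomputable def ofFun (n : ℕ) (f : ℕ → ℕ) (hlt : ∀ i < n, f i < n)
    (hinj : ∀ i < n, ∀ j < n, f i = f j → i = j)
    (havoid : ∀ i j k, i < j → j < k → k < n → f j < f i → f k ≤ f i) : Avoider :=
  ⟨n, Equiv.ofBijective (fun i : Fin n => (⟨f i, hlt i i.2⟩ : Fin n))
    (Finite.injective_iff_bijective.1 fun i j h =>
      Fin.ext (hinj i i.2 j j.2 (congrArg Fin.val h))), by
    rw [avoids_pattern213_iff]
    intro a b c hab hbc h
    exact not_lt.2 (havoid a b c hab hbc c.2 h)⟩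

section ofFun

variable {n : ℕ} {f : ℕ → ℕ} (hlt : ∀ i < n, f i < n) (hinj : ∀ i < n, ∀ j < n, f i = f j → i = j)
  (havoid : ∀ i j k, i < j → j < k → k < n → f j < f i → f k ≤ f i)

theorem size_ofFun : (ofFun n f hlt hinj havoid).size = n := rfl

theorem val_ofFun {i : ℕ} (hi : i < n) : (ofFun n f hlt hinj havoid).val i = f i := by
  rw [val, dif_pos (show i < (ofFun n f hlt hinj havoid).1 from hi)]
  rfl

end ofFun

theorem descents_eq_sum (a : Avoider) :
    a.descents = ∑ i ∈ range a.size, if i + 1 < a.size ∧ a.val (i + 1) < a.val i then 1 else 0 := by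
  classical
  rw [Finset.sum_range, descents, des, Nat.card_eq_fintype_card, Fintype.card_subtype,
    Finset.card_filter]
  refine Finset.sum_congr rfl fun i _ => if_congr ?_ rfl rfl
  constructor
  · rintro ⟨h, h'⟩
    refine ⟨h, ?_⟩
    rw [val_eq a i.2, val_eq a h]
    exact h'
  · rintro ⟨h, h'⟩
    refine ⟨h, ?_⟩
    rw [val_eq a i.2, val_eq a h] at h'
    exact h'

theorem drop_le_iff (a : Avoider) {k : ℕ} : a.drop ≤ k ↔ ∀ i < a.size, i ≤ a.val i + k := by
  rw [drop, maxdrop, Finset.sup_le_iff]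
  constructor
  · intro h i hi
    have := h ⟨i, hi⟩ (mem_univ _)
    rw [val_eq a hi]
    simp only at this
    omega
  · intro h i _
    have := h i i.2
    rw [val_eq a i.2] at this
    change (i : ℕ) ≤ a.2.1 i + k at this
    omega

theorem finite_size_eq (n : ℕ) : {a : Avoider | a.size = n}.Finite := by
  refine (Set.finite_range (fun π : {π : Equiv.Perm (Fin n) // Avoids pattern213 π} =>
    (⟨n, π⟩ : Avoider))).subset ?_
  rintro ⟨m, π⟩ rfl
  exact ⟨π, rfl⟩

/-! ### Decomposition at the smallest letter -/

/-- The one-line notation of `L 0 R`, with the letters of `L` above those of `R`. -/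
def joinFun (a b : Avoider) (i : ℕ) : ℕ :=
  if i < a.size then b.size + 1 + a.val i else if i = a.size then 0 else b.val (i - a.size - 1) + 1

theorem joinFun_left {a b : Avoider} {i : ℕ} (h : i < a.size) :
    joinFun a b i = b.size + 1 + a.val i := if_pos h

theorem joinFun_mid (a b : Avoider) : joinFun a b a.size = 0 := by simp [joinFun]

theorem joinFun_right (a b : Avoider) (j : ℕ) :
    joinFun a b (a.size + 1 + j) = b.val j + 1 := by
  rw [joinFun, if_neg (by omega), if_neg (by omega)]
  congr 2
  omega

theorem pos_cases (l : ℕ) (i : ℕ) : i < l ∨ i = l ∨ ∃ j, i = l + 1 + j := by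
  rcases lt_trichotomy i l with h | h | h
  · exact .inl h
  · exact .inr (.inl h)
  · exact .inr (.inr ⟨i - l - 1, by omega⟩)

/-- The avoider `L 0 R`. -/
noncomputable def join (a b : Avoider) : Avoider :=
  ofFun (a.size + 1 + b.size) (joinFun a b)
    (by
      intro i hi
      rcases pos_cases a.size i with h | rfl | ⟨j, rfl⟩
      · rw [joinFun_left h]; have := a.val_lt h; omega
      · rw [joinFun_mid]; omega
      · rw [joinFun_right]; have := b.val_lt (i := j) (by omega); omega)
    (by
      intro i hi i' hi' h
      rcases pos_cases a.size i with h1 | rfl | ⟨j, rfl⟩ <;>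
      rcases pos_cases a.size i' with h2 | rfl | ⟨j', rfl⟩ <;>
      simp only [joinFun_left, joinFun_mid, joinFun_right, *] at h
      · exact a.val_inj h1 h2 (by omega)
      · omega
      · have := b.val_lt (i := j') (by omega); omega
      · omega
      · omega
      · omega
      · have := b.val_lt (i := j) (by omega); omega
      · omega
      · have := b.val_inj (i := j) (j := j') (by omega) (by omega) (by omega); omega)
    (by
      intro i j k hij hjk hk h
      rcases pos_cases a.size i with h1 | rfl | ⟨i, rfl⟩
      · rw [joinFun_left h1] at h ⊢
        rcases pos_cases a.size k with h2 | rfl | ⟨k, rfl⟩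
        · rw [joinFun_left h2]
          rw [joinFun_left (hjk.trans h2)] at h
          have := a.val_avoids hij hjk h2 (by omega)
          omega
        · rw [joinFun_mid]; omega
        · rw [joinFun_right]; have := b.val_lt (i := k) (by omega); omega
      · rw [joinFun_mid] at h; omega
      · obtain ⟨j, rfl⟩ : ∃ j', j = a.size + 1 + j' := ⟨j - a.size - 1, by omega⟩
        obtain ⟨k, rfl⟩ : ∃ k', k = a.size + 1 + k' := ⟨k - a.size - 1, by omega⟩
        rw [joinFun_right, joinFun_right] at h ⊢
        have := b.val_avoids (i := i) (j := j) (k := k) (by omega) (by omega) (by omega) (by omega)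
        omega)

theorem size_join (a b : Avoider) : (join a b).size = a.size + 1 + b.size := rfl

theorem val_join (a b : Avoider) {i : ℕ} (hi : i < a.size + 1 + b.size) :
    (join a b).val i = joinFun a b i := val_ofFun _ _ _ hi

theorem descents_join (a b : Avoider) :
    (join a b).descents = a.descents + (if a.size = 0 then 0 else 1) + b.descents := by
  rw [descents_eq_sum, descents_eq_sum a, descents_eq_sum b, size_join, Finset.sum_range_add,
    Finset.sum_range_succ]
  have hmid : (if a.size + 1 < a.size + 1 + b.size ∧
      (join a b).val (a.size + 1) < (join a b).val a.size then 1 else 0) = 0 := by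
    rw [if_neg]
    rw [val_join (i := a.size) a b (by omega), joinFun_mid]
    omega
  have hright : ∀ j ∈ range b.size, (if a.size + 1 + j + 1 < a.size + 1 + b.size ∧
      (join a b).val (a.size + 1 + j + 1) < (join a b).val (a.size + 1 + j) then 1 else 0) =
      if j + 1 < b.size ∧ b.val (j + 1) < b.val j then 1 else 0 := by
    intro j hj
    rw [mem_range] at hj
    refine if_congr ?_ rfl rfl
    rw [add_assoc _ j 1, Nat.add_lt_add_iff_left]
    refine and_congr_right fun h => ?_
    rw [val_join _ _ (by omega), val_join _ _ (by omega), joinFun_right, joinFun_right]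
    omega
  -- The last letter of L stands before the 0, which gives the extra descent.
  have hleft : ∀ i ∈ range a.size, (if i + 1 < a.size + 1 + b.size ∧
      (join a b).val (i + 1) < (join a b).val i then 1 else 0) =
      (if i + 1 < a.size ∧ a.val (i + 1) < a.val i then 1 else 0) +
        (if i = a.size - 1 then 1 else 0) := by
    intro i hi
    rw [mem_range] at hi
    rw [val_join _ _ (by omega), val_join _ _ (by omega), joinFun_left hi]
    by_cases h : i + 1 < a.size
    · rw [joinFun_left h, if_neg (show ¬ i = a.size - 1 by omega), add_zero]
      exact if_congr (by omega) rfl rfl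
    · obtain h' : i + 1 = a.size := by omega
      rw [if_neg (show ¬ (i + 1 < a.size ∧ _) by omega), if_pos (show i = a.size - 1 by omega), h',
        joinFun_mid, if_pos (by omega)]
  rw [hmid, Finset.sum_congr rfl hright, Finset.sum_congr rfl hleft, Finset.sum_add_distrib,
    Finset.sum_ite_eq', add_zero]
  congr 2
  by_cases h : a.size = 0
  · simp [h]
  · rw [if_pos (by rw [mem_range]; omega), if_neg h]

/-- The 0 drops by |L|, and a letter of L at position i < |L| drops by less. Letters of R move |L| +
1 places right but rise by only 1, so their drops grow by |L|. -/
theorem drop_join_le_iff (a b : Avoider) {k : ℕ} :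
    (join a b).drop ≤ k ↔ ∃ k', k = a.size + k' ∧ b.drop ≤ k' := by
  simp only [drop_le_iff, size_join]
  constructor
  · intro h
    have hl := h a.size (by omega)
    rw [val_join _ _ (by omega), joinFun_mid] at hl
    refine ⟨k - a.size, by omega, fun j hj => ?_⟩
    have := h (a.size + 1 + j) (by omega)
    rw [val_join _ _ (by omega), joinFun_right] at this
    omega
  · rintro ⟨k, rfl, h⟩ i hi
    rw [val_join _ _ hi]
    rcases pos_cases a.size i with h1 | rfl | ⟨j, rfl⟩
    · omega
    · omega
    · have := h j (by omega)
      rw [joinFun_right]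
      omega

theorem drop_le_size (a : Avoider) : a.drop ≤ a.size := by
  rw [drop_le_iff]; intro i hi; omega

theorem join_injective : Function.Injective fun x : Avoider × Avoider => join x.1 x.2 := by
  rintro ⟨a, b⟩ ⟨a', b'⟩ h
  dsimp only at h
  have hs : a.size + 1 + b.size = a'.size + 1 + b'.size := congrArg size h
  have hv : ∀ i < a.size + 1 + b.size, joinFun a b i = joinFun a' b' i := fun i hi => by
    rw [← val_join a b hi, h, val_join a' b' (hs ▸ hi)]
  -- The size of the left factor is the position of the letter 0.
  have hl : a.size = a'.size := by
    refine (join a b).val_inj (by rw [size_join]; omega) (by rw [size_join]; omega) ?_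
    rw [val_join _ _ (by omega), val_join _ _ (by omega), hv a'.size (by omega), joinFun_mid,
      joinFun_mid]
  have hr : b.size = b'.size := by omega
  refine Prod.ext (Avoider.ext hl fun i hi => ?_) (Avoider.ext hr fun j hj => ?_)
  · change i < a.size at hi
    have := hv i (by omega)
    rw [joinFun_left hi, joinFun_left (hl ▸ hi)] at this
    dsimp only
    omega
  · change j < b.size at hj
    have := hv (a.size + 1 + j) (by omega)
    rw [joinFun_right, hl, joinFun_right] at this
    dsimp only
    omega

theorem exists_join (c : Avoider) (hc : c.size ≠ 0) : ∃ a b, join a b = c := by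
  obtain ⟨l, hl, h0⟩ := c.exists_val_eq (y := 0) (by omega)
  obtain ⟨r, hr⟩ : ∃ r, c.size = l + 1 + r := ⟨c.size - l - 1, by omega⟩
  have hpos : ∀ i < c.size, i ≠ l → 0 < c.val i := fun i hi hil =>
    Nat.pos_of_ne_zero fun h => hil (c.val_inj hi hl (h.trans h0.symm))
  have hlr : ∀ i < l, ∀ j < r, c.val (l + 1 + j) < c.val i := by
    intro i hi j hj
    have h1 := c.val_avoids hi (show l < l + 1 + j by omega) (by omega)
      (by rw [h0]; exact hpos i (by omega) (by omega))
    refine lt_of_le_of_ne h1 fun h => ?_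
    have := c.val_inj (by omega) (by omega) h
    omega
  have hleft : ∀ i < l, r + 1 ≤ c.val i := by
    intro i hi
    -- The r + 1 distinct letters of 0 R all lie below a letter of L.
    have hsub : (Finset.Ico l (l + 1 + r)).image c.val ⊆ range (c.val i) := by
      intro y hy
      obtain ⟨j, hj, rfl⟩ := mem_image.1 hy
      rw [mem_Ico] at hj
      rw [mem_range]
      rcases pos_cases l j with h | rfl | ⟨j, rfl⟩
      · omega
      · rw [h0]; exact hpos i (by omega) (by omega)
      · exact hlr i hi j (by omega)
    have := card_le_card hsub
    rw [card_image_of_injOn, Nat.card_Ico, card_range] at this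
    · omega
    · intro i hi j hj h
      simp only [coe_Ico, Set.mem_Ico] at hi hj
      exact c.val_inj (by omega) (by omega) h
  have hright : ∀ j < r, c.val (l + 1 + j) ≤ r := by
    intro j hj
    -- Dually, the l letters of L all lie above a letter of R.
    have hsub : (range l).image c.val ⊆ Ioo (c.val (l + 1 + j)) (l + 1 + r) := by
      intro y hy
      obtain ⟨i, hi, rfl⟩ := mem_image.1 hy
      rw [mem_range] at hi
      rw [mem_Ioo]
      exact ⟨hlr i hi j hj, by rw [← hr]; exact c.val_lt (by omega)⟩
    have := card_le_card hsub
    have hlt := c.val_lt (i := l + 1 + j) (by omega)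
    rw [card_image_of_injOn, Nat.card_Ioo, card_range] at this
    · omega
    · intro i hi j hj h
      simp only [coe_range, Set.mem_Iio] at hi hj
      exact c.val_inj (by omega) (by omega) h
  let a := ofFun l (fun i => c.val i - (r + 1))
    (fun i hi => by have := c.val_lt (i := i) (by omega); have := hleft i hi; omega)
    (fun i hi j hj h => c.val_inj (by omega) (by omega)
      (by have := hleft i hi; have := hleft j hj; omega))
    (fun i j k hij hjk hk h => by
      have := c.val_avoids hij hjk (by omega) (by omega)
      omega)
  let b := ofFun r (fun j => c.val (l + 1 + j) - 1)
    (fun j hj => by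
      have := hright j hj
      have := hpos (l + 1 + j) (by omega) (by omega)
      omega)
    (fun i hi j hj h => by
      have := hpos (l + 1 + j) (by omega) (by omega)
      have := hpos (l + 1 + i) (by omega) (by omega)
      have := c.val_inj (i := l + 1 + i) (j := l + 1 + j) (by omega) (by omega) (by omega)
      omega)
    (fun i j k hij hjk hk h => by
      have := c.val_avoids (i := l + 1 + i) (j := l + 1 + j) (k := l + 1 + k) (by omega) (by omega)
        (by omega) (by omega)
      omega)
  have ha : a.size = l := rfl
  have hb : b.size = r := rfl
  refine ⟨a, b, Avoider.ext (by rw [size_join, ha, hb, hr]) fun i hi => ?_⟩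
  rw [size_join] at hi
  rw [val_join _ _ hi]
  rcases pos_cases l i with h | rfl | ⟨j, rfl⟩
  · rw [joinFun_left (by omega), val_ofFun _ _ _ h, hb]
    have := hleft i h
    omega
  · exact (joinFun_mid a b).trans h0.symm
  · have hj : j < r := by omega
    rw [← ha, joinFun_right, val_ofFun _ _ _ hj, ha]
    have := hpos (l + 1 + j) (by omega) (by omega)
    omega

/-- Nonempty avoiders are pairs of avoiders. -/
noncomputable def joinEquiv : Avoider × Avoider ≃ {c : Avoider // ¬ c.size = 0} :=
  Equiv.ofBijective (fun x => ⟨join x.1 x.2, by rw [size_join]; omega⟩)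
    ⟨fun _ _ h => join_injective (congrArg Subtype.val h), fun ⟨c, hc⟩ => by
      obtain ⟨a, b, rfl⟩ := exists_join c hc
      exact ⟨(a, b), rfl⟩⟩

theorem joinEquiv_apply (x : Avoider × Avoider) : (joinEquiv x : Avoider) = join x.1 x.2 := rfl

/-! ### The quadratic equation for nonempty avoiders -/

noncomputable instance : Unique {a : Avoider // a.size = 0} where
  default := ⟨ofFun 0 id (by simp) (by simp) (by simp), rfl⟩
  uniq a := Subtype.ext (Avoider.ext a.2 fun i hi => by rw [a.2] at hi; omega)

theorem descents_of_size_eq_zero {a : Avoider} (h : a.size = 0) : a.descents = 0 := by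
  rw [descents_eq_sum, h, range_zero, Finset.sum_empty]

/-- The weight `p^des (qz)^n`. -/
noncomputable def weight (a : Avoider) : Fin 3 →₀ ℕ := expo a.descents a.size a.size

/-- The weight of an avoider placed in front of a smaller letter, which makes one more descent. -/
noncomputable def leftWeight (a : Avoider) : Fin 3 →₀ ℕ :=
  expo (a.descents + if a.size = 0 then 0 else 1) a.size a.size

theorem finite_of_size {w : Avoider → Fin 3 →₀ ℕ} (hw : ∀ a, w a 2 = a.size) (e : Fin 3 →₀ ℕ) :
    Finite {a // w a = e} :=
  ((finite_size_eq (e 2)).subset fun a (ha : w a = e) => by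
    rw [Set.mem_ofPred_eq, ← hw, ha]).to_subtype

theorem finite_weight (e : Fin 3 →₀ ℕ) : Finite {a // weight a = e} :=
  finite_of_size (fun _ => rfl) e

theorem finite_leftWeight (e : Fin 3 →₀ ℕ) : Finite {a // leftWeight a = e} :=
  finite_of_size (fun _ => rfl) e

/-- The generating function of the nonempty avoiders, by `p^des (qz)^n`. -/
noncomputable def nonemptySeries : MvPowerSeries (Fin 3) ℚ :=
  genFun fun a : {a : Avoider // ¬ a.size = 0} => weight a

theorem finite_nonempty (e : Fin 3 →₀ ℕ) :
    Finite {a : {a : Avoider // ¬ a.size = 0} // weight a = e} := by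
  have := finite_weight e
  exact Finite.of_injective
    (fun a => (⟨a.1.1, a.2⟩ : {a // weight a = e}))
    fun a b h => Subtype.ext (Subtype.ext (congrArg (fun x => x.1) h))

theorem genFun_weight : genFun weight = 1 + nonemptySeries := by
  rw [genFun_add_compl weight finite_weight (fun a => a.size = 0), genFun_unique, nonemptySeries]
  congr 1
  rw [weight, (default : {a : Avoider // a.size = 0}).2,
    descents_of_size_eq_zero (default : {a : Avoider // a.size = 0}).2, monomial_expo]
  simp

theorem genFun_leftWeight : genFun leftWeight = 1 + X 0 * nonemptySeries := by
  rw [genFun_add_compl leftWeight finite_leftWeight (fun a => a.size = 0), genFun_unique,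
    nonemptySeries]
  congr 1
  · rw [leftWeight, (default : {a : Avoider // a.size = 0}).2,
      descents_of_size_eq_zero (default : {a : Avoider // a.size = 0}).2, monomial_expo]
    simp
  · have h := genFun_shift (expo 1 0 0) _ finite_nonempty
    rw [monomial_expo] at h
    simp only [pow_one, pow_zero, mul_one] at h
    rw [← h]
    congr 1
    funext a
    rw [leftWeight, weight, expo_add, if_neg a.2, zero_add, add_comm 1]

theorem finite_prod {α β : Type*} {u : α → Fin 3 →₀ ℕ} {v : β → Fin 3 →₀ ℕ}
    (hu : ∀ e, Finite {a // u a = e}) (hv : ∀ e, Finite {b // v b = e}) (e : Fin 3 →₀ ℕ) :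
    Finite {x : α × β // u x.1 + v x.2 = e} := by
  classical
  refine Finite.of_injective (β := Σ p : antidiagonal e, {a // u a = p.1.1} × {b // v b = p.1.2})
    (fun x => ⟨⟨(u x.1.1, v x.1.2), mem_antidiagonal.2 x.2⟩, ⟨x.1.1, rfl⟩, ⟨x.1.2, rfl⟩⟩) ?_
  intro x y h
  have h1 := congrArg (fun t => (t.2.1.1, t.2.2.1)) h
  exact Subtype.ext h1

theorem nonemptySeries_eq :
    nonemptySeries = X 1 * X 2 * ((1 + X 0 * nonemptySeries) * (1 + nonemptySeries)) := by
  have h := genFun_prod _ _ finite_leftWeight finite_weight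
  have h' := genFun_shift (expo 0 1 1) _ (finite_prod finite_leftWeight finite_weight)
  rw [h, monomial_expo, genFun_leftWeight, genFun_weight] at h'
  simp only [pow_one, pow_zero, one_mul] at h'
  rw [← h']
  refine (genFun_congr joinEquiv fun x => ?_).symm
  rw [joinEquiv_apply, weight, leftWeight, weight, expo_add, expo_add, descents_join, size_join]
  congr 1 <;> ring

end Avoider

/-! ### Avoiders with a bound on the drops -/

open Avoider

/-- Pairs of an avoider of length `n` and a bound `k ≤ n` for its maximum drop size. -/
def Bounded : Type := {x : Avoider × ℕ // x.1.drop ≤ x.2 ∧ x.2 ≤ x.1.size}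

namespace Bounded

/-- The weight `p^des q^k z^n`. -/
noncomputable def weight (x : Bounded) : Fin 3 →₀ ℕ := expo x.1.1.descents x.1.2 x.1.1.size

theorem finite_weight (e : Fin 3 →₀ ℕ) : Finite {x // weight x = e} := by
  have h1 := (finite_size_eq (e 2)).to_subtype
  refine Finite.of_injective (β := {a : Avoider | a.size = e 2})
    (fun x => ⟨x.1.1.1, (expo_eq_iff.1 x.2).2.2⟩) fun x y h => ?_
  have hx := (expo_eq_iff.1 x.2).2.1
  have hy := (expo_eq_iff.1 y.2).2.1
  exact Subtype.ext (Subtype.ext (Prod.ext (congrArg Subtype.val h) (hx.trans hy.symm)))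

/-- Where the bound is the length, it is no condition. -/
def fullEquiv : Avoider ≃ {x : Bounded // x.1.2 = x.1.1.size} where
  toFun a := ⟨⟨(a, a.size), a.drop_le_size, le_rfl⟩, rfl⟩
  invFun x := x.1.1.1
  left_inv _ := rfl
  right_inv x := Subtype.ext (Subtype.ext (Prod.ext rfl x.2.symm))

/-- Decomposition at the smallest letter, where the bound is less than the length. -/
noncomputable def joinEquiv : Avoider × Bounded ≃ {x : Bounded // ¬ x.1.2 = x.1.1.size} :=
  Equiv.ofBijective
    (fun x => ⟨⟨(join x.1 x.2.1.1, x.1.size + x.2.1.2), by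
        refine ⟨(drop_join_le_iff _ _).2 ⟨_, rfl, x.2.2.1⟩, ?_⟩
        have := x.2.2.2
        simp only [size_join]
        omega⟩, by
      have := x.2.2.2
      simp only [size_join]
      omega⟩)
    (by
      constructor
      · rintro ⟨a, ⟨b, k⟩, hb⟩ ⟨a', ⟨b', k'⟩, hb'⟩ h
        have h' := congrArg (fun x => x.1.1) h
        simp only [Prod.mk.injEq] at h'
        obtain ⟨rfl, rfl⟩ := Prod.mk.inj (join_injective (a₁ := (a, b)) (a₂ := (a', b')) h'.1)
        obtain rfl : k = k' := by omega
        rfl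
      · rintro ⟨⟨⟨c, k⟩, hd, hk⟩, hne⟩
        dsimp only at hd hk hne
        obtain ⟨a, b, rfl⟩ := exists_join c (by omega)
        obtain ⟨k, rfl, hb⟩ := (drop_join_le_iff a b).1 hd
        rw [size_join] at hk hne
        exact ⟨(a, ⟨(b, k), hb, by dsimp only; omega⟩), rfl⟩)

theorem joinEquiv_apply (x : Avoider × Bounded) :
    (joinEquiv x).1.1 = (join x.1 x.2.1.1, x.1.size + x.2.1.2) := rfl

/-- The first summand is the case k = n. In the other, L contributes |L| to both k and n, hence
carries (qz)^|L|, while the 0 adds to n only, hence the lone factor z. -/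
theorem genFun_weight_eq :
    genFun weight =
      (1 + nonemptySeries) + X 2 * ((1 + X 0 * nonemptySeries) * genFun weight) := by
  have h := genFun_prod _ _ finite_leftWeight finite_weight
  have h' := genFun_shift (expo 0 0 1) _ (finite_prod finite_leftWeight finite_weight)
  rw [h, monomial_expo, genFun_leftWeight] at h'
  simp only [pow_one, pow_zero, one_mul] at h'
  rw [← h', ← genFun_weight]
  rw [genFun_add_compl weight finite_weight (fun x => x.1.2 = x.1.1.size)]
  congr 1
  · exact (genFun_congr fullEquiv fun a => rfl).symm
  · refine (genFun_congr joinEquiv fun x => ?_).symm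
    rw [weight, joinEquiv_apply, leftWeight, weight, expo_add, expo_add, descents_join, size_join]
    congr 1 <;> ring

theorem card_eq (d k n : ℕ) (hk : k ≤ n) :
    Nat.card {π : Equiv.Perm (Fin n) // π ∈ boundedAvoiding n k pattern213 ∧ des π = d} =
      Nat.card {x : Bounded // x.1.1.descents = d ∧ x.1.2 = k ∧ x.1.1.size = n} := by
  refine Nat.card_congr (Equiv.ofBijective
    (fun π => ⟨⟨(⟨n, π.1, π.2.1.2⟩, k), π.2.1.1, hk⟩, π.2.2, rfl, rfl⟩) ⟨?_, ?_⟩)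
  · rintro ⟨π, hπ⟩ ⟨ρ, hρ⟩ h
    have h' : (⟨n, π, hπ.1.2⟩ : Σ n : ℕ, {π : Equiv.Perm (Fin n) // Avoids pattern213 π}) =
        ⟨n, ρ, hρ.1.2⟩ := congrArg (fun x => x.1.1.1) h
    exact Subtype.ext (Subtype.mk.inj (eq_of_heq (Sigma.mk.inj h').2))
  · rintro ⟨⟨⟨⟨n, π, hπ⟩, k⟩, hd, hk⟩, rfl, rfl, rfl⟩
    exact ⟨⟨π, ⟨hd, hπ⟩, rfl⟩, rfl⟩

end Bounded

theorem G_eq_genFun : G = genFun Bounded.weight := by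
  ext e
  rw [coeff_genFun]
  change (if e 1 ≤ e 2 then _ else _) = _
  split_ifs with h
  · rw [Bounded.card_eq _ _ _ h]
    exact congrArg _ (Nat.card_congr (Equiv.subtypeEquivRight fun x => expo_eq_iff.symm))
  · have : IsEmpty {x // Bounded.weight x = e} := ⟨fun x => h (by
      obtain ⟨-, h1, h2⟩ := expo_eq_iff.1 x.2
      rw [← h1, ← h2]
      exact x.1.2.2)⟩
    simp

/-- There are no zero divisors, and S' = -S is excluded because S' + S has constant term 2. -/
theorem IsSqrt.unique {S S' A : MvPowerSeries (Fin 3) ℚ} (h : IsSqrt S A) (h' : IsSqrt S' A) :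
    S' = S := by
  have h0 : (S' - S) * (S' + S) = 0 := by linear_combination h'.1 - h.1
  rcases mul_eq_zero.1 h0 with h1 | h1
  · exact sub_eq_zero.1 h1
  · have := congrArg constantCoeff h1
    rw [map_add, h.2, h'.2, map_zero] at this
    norm_num at this

end BoundedPerm

/-! ### Solving the two functional equations -/

theorem theorem1p4 (p q z : MvPowerSeries (Fin 3) ℚ)
    (hp : p = MvPowerSeries.X 0) (hq : q = MvPowerSeries.X 1) (hz : z = MvPowerSeries.X 2) :
    ∃ S F : MvPowerSeries (Fin 3) ℚ,
      (BoundedPerm.IsSqrt S ((1 + z * q * (1 - p)) ^ 2 - 4 * z * q) ∧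
        ∀ S', BoundedPerm.IsSqrt S' ((1 + z * q * (1 - p)) ^ 2 - 4 * z * q) → S' = S) ∧
      (2 * p * q * z * F = 1 - z * q * (1 + p) - S ∧
        ∀ F', 2 * p * q * z * F' = 1 - z * q * (1 + p) - S → F' = F) ∧
      IsUnit (1 - z - p * q * z - (1 - z) * q) ∧
      BoundedPerm.G =
        (1 - p * q * z - (1 - z) * q + (z * q - p * q * z - q) * F) *
          (1 - z - p * q * z - (1 - z) * q)⁻¹ := by
  have hF := BoundedPerm.Avoider.nonemptySeries_eq
  have hG := BoundedPerm.Bounded.genFun_weight_eq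
  rw [← BoundedPerm.G_eq_genFun] at hG
  rw [← hp, ← hz] at hG
  rw [← hp, ← hq, ← hz] at hF
  generalize BoundedPerm.Avoider.nonemptySeries = F at hF hG
  have cp : MvPowerSeries.constantCoeff p = 0 := by rw [hp, MvPowerSeries.constantCoeff_X]
  have cq : MvPowerSeries.constantCoeff q = 0 := by rw [hq, MvPowerSeries.constantCoeff_X]
  have cz : MvPowerSeries.constantCoeff z = 0 := by rw [hz, MvPowerSeries.constantCoeff_X]
  -- Completing the square in the quadratic for F: the root is defined from F, so divisibility by
  -- 2pqz is automatic.
  have hS : BoundedPerm.IsSqrt (1 - z * q * (1 + p) - 2 * p * q * z * F)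
      ((1 + z * q * (1 - p)) ^ 2 - 4 * z * q) :=
    ⟨by linear_combination (4 * p * q * z) * -hF, by simp [cp, cq, cz]⟩
  have hD : MvPowerSeries.constantCoeff (1 - z - p * q * z - (1 - z) * q) = 1 := by
    simp [cp, cq, cz]
  refine ⟨_, F, ⟨hS, fun S' hS' => hS.unique hS'⟩, ⟨by ring, fun F' hF' => ?_⟩, ?_, ?_⟩
  · have hX : ∀ i : Fin 3, (MvPowerSeries.X i : MvPowerSeries (Fin 3) ℚ) ≠ 0 := fun i h => by
      have := congrArg (MvPowerSeries.coeff (Finsupp.single i 1)) h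
      simp [MvPowerSeries.coeff_X] at this
    have h2 : (2 : MvPowerSeries (Fin 3) ℚ) ≠ 0 := fun h => by
      have := congrArg MvPowerSeries.constantCoeff h
      rw [map_ofNat, map_zero] at this
      norm_num at this
    have h0 : 2 * p * q * z ≠ 0 := by
      rw [hp, hq, hz]
      exact mul_ne_zero (mul_ne_zero (mul_ne_zero h2 (hX 0)) (hX 1)) (hX 2)
    exact mul_left_cancel₀ h0 (by rw [hF']; ring)
  · rw [MvPowerSeries.isUnit_iff_constantCoeff, hD]
    exact isUnit_one
  · rw [MvPowerSeries.eq_mul_inv_iff_mul_eq (by rw [hD]; exact one_ne_zero)]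
    -- The equation for G reads G(1 - z(1 + pF)) = 1 + F; multiplying the goal by this factor
    -- eliminates G and leaves a multiple of the quadratic.
    have h0 : 1 - z * (1 + p * F) ≠ 0 := fun h => by
      have := congrArg MvPowerSeries.constantCoeff h
      simp [cz] at this
    refine mul_right_cancel₀ h0 ?_
    linear_combination (1 - z - p * q * z - (1 - z) * q) * hG - (z - p * z - 1) * hF
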